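/- Let $H$ be a separable real Hilbert space. A generalized $H$-valued function $Z$ on a probability space $(S,\nu)$ is a continuous linear operator $\xi\mapsto\langle Z,\xi\rangle$ from $H$ to $L^0(S,\nu)$, the space of $\nu$-equivalence classes of real measurable functions with the topology of convergence in measure; its law is the joint distribution of all $\langle Z,\xi\rangle$, $\xi\in H$. Let $X$ be a standard Gaussian in $H$ on a standard probability space $(\Omega,\mathsf P)$, i.e. a generalized $H$-valued function on $(\Omega,\mathsf P)$ such that each $\langle X,\xi\rangle$ is a centered Gaussian variable of variance $\|\xi\|^2$. Let $(\mathcal T,\mu)$ be a standard probability space and let $Y$ be a randomized shift on $(\mathcal T,\mu)$, i.e. a generalized $H$-valued function on $(\mathcal T,\mu)$ such that $\mathrm{Law}_{\mathsf P\otimes\mu}[X+Y]\ll\mathrm{Law}_{\mathsf P}X$, where $X+Y$ on $\Omega\times\mathcal T$ is given by $\langle X,\xi\rangle(\omega)+\langle Y,\xi\rangle(t)$. Then for every $n\in\mathbb N$ there is a probability measure $\mu_n'$ on $\mathcal T$, equivalent to $\mu$ (same null sets), such that $\mathsf E_{\mu_n'}|\langle Y,\xi\rangle|^n<\infty$ for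 all $\xi\in H$, and the symmetric tensor $\mathsf E_{\mu_n'}Y^{\otimes n}$, defined by the polarization $(\xi_1,\dots,\xi_n)\mapsto\mathsf E_{\mu_n'}\langle Y,\xi_1\rangle\cdots\langle Y,\xi_n\rangle$ of $\xi\mapsto\mathsf E_{\mu_n'}\langle Y,\xi\rangle^n$, is Hilbert–Schmidt: there is an element $\Lambda$ of the Hilbert tensor power $H^{\otimes n}$ (the completion of the algebraic tensor power with respect to $\langle\xi_1\otimes\dots\otimes\xi_n,\eta_1\otimes\dots\otimes\eta_n\rangle=\prod_i\langle\xi_i,\eta_i\rangle$) with $\langle\Lambda,\xi_1\otimes\dots\otimes\xi_n\rangle=\mathsf E_{\mu_n'}\langle Y,\xi_1\rangle\cdots\langle Y,\xi_n\rangle$ for all $\xi_1,\dots,\xi_n\in H$. -/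

import Mathlib

open MeasureTheory ProbabilityTheory Filter Topology
open scoped TensorProduct RealInnerProductSpace

noncomputable section

/-! ### Generalized `H`-valued functions -/

/-- A generalized `H`-valued function on `(T, μ)`: a linear operator from `H` to the space of
`μ`-equivalence classes of real measurable functions, continuous for convergence in measure
(`μ` is meant to be a finite measure). `Y ξ` is the (class of the) function `⟨Y, ξ⟩`. -/
structure GeneralizedFunction (H : Type*) [NormedAddCommGroup H] [InnerProductSpace ℝ H]
    {T : Type*} [MeasurableSpace T] (μ : Measure T) extends H →ₗ[ℝ] (T →ₘ[μ] ℝ) where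
  continuous_inMeasure : ∀ ξ : H,
    TendstoInMeasure μ (fun (η : H) (t : T) => toFun η t) (𝓝 ξ) (toFun ξ)

namespace GeneralizedFunction

instance {H : Type*} [NormedAddCommGroup H] [InnerProductSpace ℝ H]
    {T : Type*} [MeasurableSpace T] {μ : Measure T} :
    CoeFun (GeneralizedFunction H μ) (fun _ => H → (T →ₘ[μ] ℝ)) :=
  ⟨fun Y => Y.toFun⟩

/-- The generalized random vector `X` is standard Gaussian: each `⟨X, ξ⟩` is a centered Gaussian
random variable of variance `‖ξ‖ ^ 2`. -/
def IsStandardGaussian {H : Type*} [NormedAddCommGroup H] [InnerProductSpace ℝ H]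
    {Ω : Type*} [MeasurableSpace Ω] {P : Measure Ω} (X : GeneralizedFunction H P) : Prop :=
  ∀ ξ : H, HasLaw (X ξ) (gaussianReal 0 (‖ξ‖₊ ^ 2)) P

/-- The law of `X`: the joint distribution of all its linear functionals `⟨X, ξ⟩`, `ξ ∈ H`, a
measure on `H → ℝ` with the product `σ`-algebra. Each set of this `σ`-algebra depends on countably
many coordinates only, so the choice of representatives does not matter. -/
def law {H : Type*} [NormedAddCommGroup H] [InnerProductSpace ℝ H]
    {Ω : Type*} [MeasurableSpace Ω] {P : Measure Ω} (X : GeneralizedFunction H P) :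
    Measure (H → ℝ) :=
  P.map (fun ω ξ => X ξ ω)

/-- The law of `X + Y` on the product space `(Ω × T, P ⊗ μ)`, on which `X` and `Y` are
independent: the joint distribution of all `⟨X, ξ⟩ + ⟨Y, ξ⟩`, `ξ ∈ H`. -/
def lawAdd {H : Type*} [NormedAddCommGroup H] [InnerProductSpace ℝ H]
    {Ω : Type*} [MeasurableSpace Ω] {P : Measure Ω} (X : GeneralizedFunction H P)
    {T : Type*} [MeasurableSpace T] {μ : Measure T} (Y : GeneralizedFunction H μ) :
    Measure (H → ℝ) :=
  (P.prod μ).map (fun p ξ => X ξ p.1 + Y ξ p.2)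

/-- The map whose image measure is `law X` is measurable. -/
theorem measurable_law_map {H : Type*} [NormedAddCommGroup H] [InnerProductSpace ℝ H]
    {Ω : Type*} [MeasurableSpace Ω] {P : Measure Ω} (X : GeneralizedFunction H P) :
    Measurable (fun (ω : Ω) (ξ : H) => X ξ ω) :=
  measurable_pi_iff.2 fun ξ => (X ξ).measurable

/-- The map whose image measure is `lawAdd X Y` is measurable. -/
theorem measurable_lawAdd_map {H : Type*} [NormedAddCommGroup H] [InnerProductSpace ℝ H]
    {Ω : Type*} [MeasurableSpace Ω] {P : Measure Ω} (X : GeneralizedFunction H P)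
    {T : Type*} [MeasurableSpace T] {μ : Measure T} (Y : GeneralizedFunction H μ) :
    Measurable (fun (p : Ω × T) (ξ : H) => X ξ p.1 + Y ξ p.2) :=
  measurable_pi_iff.2 fun ξ =>
    ((X ξ).measurable.comp measurable_fst).add ((Y ξ).measurable.comp measurable_snd)

/-- `Y` is a randomized shift of `X`: the law of `X + Y` under `P ⊗ μ` is absolutely continuous
with respect to the law of `X` under `P`. -/
def IsRandomizedShift {H : Type*} [NormedAddCommGroup H] [InnerProductSpace ℝ H]
    {Ω : Type*} [MeasurableSpace Ω] {P : Measure Ω} (X : GeneralizedFunction H P)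
    {T : Type*} [MeasurableSpace T] {μ : Measure T} (Y : GeneralizedFunction H μ) : Prop :=
  lawAdd X Y ≪ law X

/-- The symmetric `n`-linear form `(ξ₁, …, ξₙ) ↦ E_ν ⟨Y, ξ₁⟩ ⋯ ⟨Y, ξₙ⟩` of the tensor
`E_ν Y^{⊗ n}`, that is, the polarization of `ξ ↦ E_ν ⟨Y, ξ⟩ ^ n`. -/
def momentForm {H : Type*} [NormedAddCommGroup H] [InnerProductSpace ℝ H]
    {T : Type*} [MeasurableSpace T] {μ : Measure T} (Y : GeneralizedFunction H μ)
    (ν : Measure T) (n : ℕ) (ξ : Fin n → H) : ℝ :=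
  ∫ t, ∏ i, Y (ξ i) t ∂ν

theorem momentForm_diag {H : Type*} [NormedAddCommGroup H] [InnerProductSpace ℝ H]
    {T : Type*} [MeasurableSpace T] {μ : Measure T} (Y : GeneralizedFunction H μ)
    (ν : Measure T) (n : ℕ) (ξ : H) :
    Y.momentForm ν n (fun _ => ξ) = ∫ t, (Y ξ t) ^ n ∂ν := by
  simp [momentForm]

theorem momentForm_perm {H : Type*} [NormedAddCommGroup H] [InnerProductSpace ℝ H]
    {T : Type*} [MeasurableSpace T] {μ : Measure T} (Y : GeneralizedFunction H μ)
    (ν : Measure T) (n : ℕ) (ξ : Fin n → H) (σ : Equiv.Perm (Fin n)) :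
    Y.momentForm ν n (fun i => ξ (σ i)) = Y.momentForm ν n ξ := by
  unfold momentForm
  congr 1
  funext t
  exact Equiv.prod_comp σ (fun i => Y (ξ i) t)

end GeneralizedFunction

/-! ### Hilbert tensor powers -/

/-- The algebraic tensor power `H ⊗ ⋯ ⊗ H` (`n` factors), as a type of its own, so that it does not
carry the projective seminorm. -/
def AlgTensorPower (n : ℕ) (H : Type*) [NormedAddCommGroup H] [InnerProductSpace ℝ H] : Type _ :=
  ⨂[ℝ]^n H

namespace AlgTensorPower

instance (n : ℕ) (H : Type*) [NormedAddCommGroup H] [InnerProductSpace ℝ H] :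
    AddCommGroup (AlgTensorPower n H) :=
  inferInstanceAs (AddCommGroup (⨂[ℝ] _ : Fin n, H))

instance (n : ℕ) (H : Type*) [NormedAddCommGroup H] [InnerProductSpace ℝ H] :
    Module ℝ (AlgTensorPower n H) :=
  inferInstanceAs (Module ℝ (⨂[ℝ] _ : Fin n, H))

/-- The decomposable tensor `ξ₁ ⊗ ⋯ ⊗ ξₙ`. -/
def pure {n : ℕ} {H : Type*} [NormedAddCommGroup H] [InnerProductSpace ℝ H] (ξ : Fin n → H) :
    AlgTensorPower n H :=
  PiTensorProduct.tprod ℝ ξ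

/-- The bilinear form with `form (ξ₁ ⊗ ⋯ ⊗ ξₙ) (η₁ ⊗ ⋯ ⊗ ηₙ) = ⟪ξ₁, η₁⟫ ⋯ ⟪ξₙ, ηₙ⟫`. -/
def form (n : ℕ) (H : Type*) [NormedAddCommGroup H] [InnerProductSpace ℝ H] :
    AlgTensorPower n H →ₗ[ℝ] AlgTensorPower n H →ₗ[ℝ] ℝ :=
  PiTensorProduct.dualDistrib (R := ℝ) (M := fun _ : Fin n => H) ∘ₗ
    PiTensorProduct.map (fun _ : Fin n => innerₗ H)

theorem form_pure {n : ℕ} {H : Type*} [NormedAddCommGroup H] [InnerProductSpace ℝ H]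
    (ξ η : Fin n → H) : form n H (pure ξ) (pure η) = ∏ i, ⟪ξ i, η i⟫ := by
  have h : form n H (pure ξ) (pure η) =
      PiTensorProduct.dualDistrib (R := ℝ) (M := fun _ : Fin n => H)
        (PiTensorProduct.map (fun _ : Fin n => innerₗ H) (PiTensorProduct.tprod ℝ ξ))
        (PiTensorProduct.tprod ℝ η) := rfl
  rw [h]
  simp

theorem exists_sum {n : ℕ} {H : Type*} [NormedAddCommGroup H] [InnerProductSpace ℝ H]
    (x : AlgTensorPower n H) :
    ∃ (N : ℕ) (c : Fin N → ℝ) (m : Fin N → Fin n → H), x = ∑ k, c k • pure (m k) := by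
  have hx : x ∈ Submodule.span ℝ (Set.range (pure : (Fin n → H) → AlgTensorPower n H)) := by
    have h : Submodule.span ℝ (Set.range (pure : (Fin n → H) → AlgTensorPower n H)) = ⊤ :=
      PiTensorProduct.span_tprod_eq_top (R := ℝ) (s := fun _ : Fin n => H)
    rw [h]
    exact Submodule.mem_top
  obtain ⟨N, c, v, rfl⟩ := Submodule.mem_span_set'.1 hx
  choose m hm using fun k => (v k).2
  exact ⟨N, c, m, by simp [hm]⟩

theorem form_symm {n : ℕ} {H : Type*} [NormedAddCommGroup H] [InnerProductSpace ℝ H]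
    (x y : AlgTensorPower n H) : form n H y x = form n H x y := by
  obtain ⟨N, c, m, rfl⟩ := exists_sum x
  obtain ⟨M, d, l, rfl⟩ := exists_sum y
  simp only [map_sum, LinearMap.sum_apply, map_smul, LinearMap.smul_apply, form_pure, smul_eq_mul,
    Finset.mul_sum]
  rw [Finset.sum_comm]
  refine Finset.sum_congr rfl fun i _ => Finset.sum_congr rfl fun j _ => ?_
  simp only [real_inner_comm]
  ring

theorem form_self_nonneg {n : ℕ} {H : Type*} [NormedAddCommGroup H] [InnerProductSpace ℝ H]
    (x : AlgTensorPower n H) : 0 ≤ form n H x x := by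
  obtain ⟨N, c, m, rfl⟩ := exists_sum x
  have key : ∀ s : Finset (Fin n),
      (Matrix.of fun k l : Fin N => ∏ i ∈ s, ⟪m k i, m l i⟫).PosSemidef := by
    intro s
    classical
    induction s using Finset.induction_on with
    | empty =>
      have h : (Matrix.of fun k l : Fin N => ∏ i ∈ (∅ : Finset (Fin n)), ⟪m k i, m l i⟫) =
          Matrix.gram ℝ (fun _ : Fin N => (1 : ℝ)) := by
        ext k l
        simp
      rw [h]
      exact Matrix.posSemidef_gram ℝ (fun _ : Fin N => (1 : ℝ))
    | insert a s ha ih =>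
      have h : (Matrix.of fun k l : Fin N => ∏ i ∈ insert a s, ⟪m k i, m l i⟫) =
          (Matrix.gram ℝ (fun k : Fin N => m k a)).hadamard
            (Matrix.of fun k l : Fin N => ∏ i ∈ s, ⟪m k i, m l i⟫) := by
        ext k l
        simp [Finset.prod_insert ha]
      rw [h]
      exact (Matrix.posSemidef_gram ℝ (fun k : Fin N => m k a)).hadamard ih
  have e : form n H (∑ k, c k • pure (m k)) (∑ k, c k • pure (m k)) =
      star c ⬝ᵥ (Matrix.of fun k l : Fin N => ∏ i, ⟪m k i, m l i⟫).mulVec c := by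
    simp only [map_sum, LinearMap.sum_apply, map_smul, LinearMap.smul_apply, form_pure,
      smul_eq_mul, dotProduct, Matrix.mulVec, Matrix.of_apply, Finset.mul_sum, Pi.star_apply,
      star_trivial]
    rw [Finset.sum_comm]
    refine Finset.sum_congr rfl fun i _ => Finset.sum_congr rfl fun j _ => ?_
    ring
  rw [e]
  exact (key Finset.univ).dotProduct_mulVec_nonneg c

instance (n : ℕ) (H : Type*) [NormedAddCommGroup H] [InnerProductSpace ℝ H] :
    PreInnerProductSpace.Core ℝ (AlgTensorPower n H) where
  inner x y := form n H x y
  conj_inner_symm x y := by simpa using form_symm x y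
  re_inner_nonneg x := by simpa using form_self_nonneg x
  add_left x y z := by simp
  smul_left x y r := by simp

instance (n : ℕ) (H : Type*) [NormedAddCommGroup H] [InnerProductSpace ℝ H] :
    SeminormedAddCommGroup (AlgTensorPower n H) :=
  InnerProductSpace.Core.toSeminormedAddCommGroup (𝕜 := ℝ)

instance (n : ℕ) (H : Type*) [NormedAddCommGroup H] [InnerProductSpace ℝ H] :
    InnerProductSpace ℝ (AlgTensorPower n H) :=
  InnerProductSpace.ofCore _

theorem inner_pure {n : ℕ} {H : Type*} [NormedAddCommGroup H] [InnerProductSpace ℝ H]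
    (ξ η : Fin n → H) : ⟪pure ξ, pure η⟫ = ∏ i, ⟪ξ i, η i⟫ :=
  form_pure ξ η

end AlgTensorPower

/-- The Hilbert tensor power `H^{⊗ n}` (the space of Hilbert–Schmidt tensors): the completion of the
algebraic tensor power for `⟪ξ₁ ⊗ ⋯ ⊗ ξₙ, η₁ ⊗ ⋯ ⊗ ηₙ⟫ = ⟪ξ₁, η₁⟫ ⋯ ⟪ξₙ, ηₙ⟫`. -/
abbrev HilbertTensorPower (n : ℕ) (H : Type*) [NormedAddCommGroup H] [InnerProductSpace ℝ H] :
    Type _ :=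
  UniformSpace.Completion (AlgTensorPower n H)

/-- The tensor with components `B ξ`, `ξ ∈ Hⁿ`, is Hilbert–Schmidt: it is an element `Λ` of
`H^{⊗ n}`, in the sense that `B (ξ₁, …, ξₙ) = ⟪Λ, ξ₁ ⊗ ⋯ ⊗ ξₙ⟫`. -/
def IsHilbertSchmidtTensor {n : ℕ} {H : Type*} [NormedAddCommGroup H] [InnerProductSpace ℝ H]
    (B : (Fin n → H) → ℝ) : Prop :=
  ∃ Λ : HilbertTensorPower n H, ∀ ξ : Fin n → H,
    B ξ = ⟪Λ, (AlgTensorPower.pure ξ : HilbertTensorPower n H)⟫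

end

/-! It suffices to show that `A ↦ ⟨Y^{⊗ n}, A⟩`, as a linear operator from the algebraic tensor
power with its Hilbert seminorm to `L⁰(μ)`, is bounded in probability. A linear operator with this
property becomes bounded into `L¹(μ')` for an equivalent probability `μ'`
(`exists_equivalent_measure_bound`). Expectation under `μ'` is then a bounded functional of `A`, and
the Riesz representation on the completion gives `Λ`.

Boundedness in probability (`IsRandomizedShift.measureReal_le`) comes from decoupling. For order `n
≥ 1`, take `n` independent copies of `X`, add `Y` to only one of them, and rotate the copies by an
orthogonal matrix with constant first column. The shift is thereby spread equally: every rotated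
copy is shifted by `Y / √n`. Only one copy was touched, so the joint law stays absolutely
continuous. Evaluate `A` on the rotated copies, one copy per tensor factor. Without the shift the
second moment is `‖A‖ ^ 2`, so large values are rare by Chebyshev. With a fixed shift `y`, averaging
over the signs of the copies recovers the value of `A` at `y`; hence if that value is large, the
shifted expression is large with probability at least `2⁻ⁿ`. Absolute continuity turns the first
bound into one on the probability that `⟨Y^{⊗ n}, A⟩` is large.

The change of density rests on an exhaustion: sets on which the weak type `(2, 2)` bound fails are
glued together by random signs, and the parallelogram law keeps the mean square norm under control.
-/

noncomputable section

/-! ### Change of density for linear operators into `L⁰` -/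

/-- Exhaustion: a class of sets of measure at most `r` admits a set whose complement has measure at
most `r`, and no subset of positive measure of which can be adjoined to members of the class. -/
theorem exists_measurableSet_exhaustion {T : Type*} [MeasurableSpace T] {μ : Measure T}
    [IsFiniteMeasure μ] {G : Set T → Prop} {r : ℝ} (hmeas : ∀ A, G A → MeasurableSet A)
    (h0 : G ∅) (hr : ∀ A, G A → μ.real A ≤ r) :
    ∃ B : Set T, MeasurableSet B ∧ μ.real Bᶜ ≤ r ∧
      ∀ D, MeasurableSet D → D ⊆ B → (∀ A, G A → Disjoint A D → G (A ∪ D)) → μ.real D = 0 := by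
  -- Greedy choice: a superset in the class whose measure is within `1 / (n + 1)` of the best
  -- available.
  have step : ∀ (n : ℕ) (A : {A // G A}), ∃ A' : {A // G A}, A.1 ⊆ A'.1 ∧
      ∀ A'', G A'' → A.1 ⊆ A'' → μ.real A'' ≤ μ.real A'.1 + 1 / ((n : ℝ) + 1) := by
    intro n A
    let s : Set ℝ := {x | ∃ A'', G A'' ∧ A.1 ⊆ A'' ∧ μ.real A'' = x}
    have hb : BddAbove s := ⟨r, by rintro x ⟨A'', h, -, rfl⟩; exact hr _ h⟩
    have hne : s.Nonempty := ⟨_, A.1, A.2, subset_rfl, rfl⟩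
    have hlt : sSup s - 1 / ((n : ℝ) + 1) < sSup s := by
      have : 0 < 1 / ((n : ℝ) + 1) := by positivity
      linarith
    obtain ⟨x, ⟨A', hA', hsub, rfl⟩, hx⟩ := exists_lt_of_lt_csSup hne hlt
    refine ⟨⟨A', hA'⟩, hsub, fun A'' h h' => ?_⟩
    have := le_csSup hb (⟨A'', h, h', rfl⟩ : μ.real A'' ∈ s)
    simp only
    linarith
  choose next hsub hnext using step
  let a : ℕ → {A // G A} := fun n => Nat.rec ⟨∅, h0⟩ next n
  have ha : ∀ n, a (n + 1) = next n (a n) := fun n => rfl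
  have hmono : Monotone fun n => (a n).1 :=
    monotone_nat_of_le_succ fun n => by rw [ha]; exact hsub n (a n)
  have hmU : MeasurableSet (⋃ n, (a n).1) := MeasurableSet.iUnion fun n => hmeas _ (a n).2
  refine ⟨(⋃ n, (a n).1)ᶜ, hmU.compl, ?_, ?_⟩
  · rw [compl_compl]
    have ht : Tendsto (fun n => μ.real (a n).1) atTop (𝓝 (μ.real (⋃ n, (a n).1))) :=
      (ENNReal.tendsto_toReal (measure_ne_top _ _)).comp (tendsto_measure_iUnion_atTop hmono)
    exact le_of_tendsto' ht fun n => hr _ (a n).2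
  · intro D hD hDB hadd
    have hdis : ∀ n, Disjoint (a n).1 D := fun n =>
      (Set.disjoint_left.2 fun t ht htD => hDB htD (Set.mem_iUnion.2 ⟨n, ht⟩))
    -- Adjoining `D` to stage `n` gives a competitor for stage `n + 1`; the increments of a
    -- convergent sequence tend to zero.
    have hle : ∀ n : ℕ, μ.real D ≤ (μ.real (a (n + 1)).1 - μ.real (a n).1) + 1 / ((n : ℝ) + 1) := by
      intro n
      have h1 := hnext n (a n) ((a n).1 ∪ D) (hadd _ (a n).2 (hdis n)) Set.subset_union_left
      rw [measureReal_union (hdis n) hD, ← ha] at h1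
      linarith
    have ht : Tendsto (fun n => μ.real (a n).1) atTop (𝓝 (μ.real (⋃ n, (a n).1))) :=
      (ENNReal.tendsto_toReal (measure_ne_top _ _)).comp (tendsto_measure_iUnion_atTop hmono)
    have hlim := ((((tendsto_add_atTop_iff_nat 1).2 ht).sub ht).add
      (tendsto_one_div_add_atTop_nhds_zero_nat (𝕜 := ℝ)))
    rw [sub_self, add_zero] at hlim
    exact le_antisymm (ge_of_tendsto' hlim hle) measureReal_nonneg

section ChangeOfDensity

variable {T : Type*} [MeasurableSpace T] {μ : Measure T}
  {V : Type*} [SeminormedAddCommGroup V] [InnerProductSpace ℝ V]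

/-- The set `A` carries a finite family of vectors of mean square norm at most `μ A / C` whose
images are, at every point of `A` and after any translation, large for at least half of the
family. -/
def IsSpreadOn (S : V →ₗ[ℝ] (T →ₘ[μ] ℝ)) (C : ℝ) (A : Set T) : Prop :=
  MeasurableSet A ∧ ∃ (ι : Type) (_ : Fintype ι) (_ : Nonempty ι) (v : ι → V),
    C * ∑ i, ‖v i‖ ^ 2 ≤ Fintype.card ι * μ.real A ∧
    ∀ᵐ t ∂μ, t ∈ A → ∀ b : ℝ,
      (Fintype.card ι : ℝ) ≤ 2 * ∑ i, Set.indicator {x : ℝ | 1 ≤ |x|} 1 (S (v i) t + b)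

theorem isSpreadOn_empty (S : V →ₗ[ℝ] (T →ₘ[μ] ℝ)) (C : ℝ) : IsSpreadOn S C ∅ :=
  ⟨MeasurableSet.empty, Unit, inferInstance, inferInstance, fun _ => 0, by simp, by simp⟩

theorem one_le_indicator_add_indicator {a b : ℝ} (ha : 1 ≤ |a|) :
    (1 : ℝ) ≤ Set.indicator {x : ℝ | 1 ≤ |x|} 1 (b + a) +
      Set.indicator {x : ℝ | 1 ≤ |x|} 1 (b - a) := by
  have h0 : ∀ x : ℝ, (0 : ℝ) ≤ Set.indicator {x : ℝ | 1 ≤ |x|} 1 x := fun x =>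
    Set.indicator_nonneg (by simp) x
  by_cases h : 1 ≤ |b + a|
  · have h' : Set.indicator {x : ℝ | 1 ≤ |x|} (1 : ℝ → ℝ) (b + a) = 1 :=
      Set.indicator_of_mem (s := {x : ℝ | 1 ≤ |x|}) h _
    linarith [h0 (b - a)]
  · have h2 : 1 ≤ |b - a| := by
      by_contra h3
      rw [not_le, abs_lt] at h h3
      have : |a| < 1 := abs_lt.2 ⟨by linarith, by linarith⟩
      linarith
    have h' : Set.indicator {x : ℝ | 1 ≤ |x|} (1 : ℝ → ℝ) (b - a) = 1 :=
      Set.indicator_of_mem (s := {x : ℝ | 1 ≤ |x|}) h2 _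
    linarith [h0 (b + a)]

/-- The new family is `v i ± w`. By the parallelogram law its mean square norm is the old one plus
`‖w‖ ^ 2`, which `μ D` pays for. -/
theorem IsSpreadOn.union [IsFiniteMeasure μ] {S : V →ₗ[ℝ] (T →ₘ[μ] ℝ)} {C : ℝ} {A D : Set T}
    (hA : IsSpreadOn S C A) (hD : MeasurableSet D) (hAD : Disjoint A D) {w : V}
    (hw : C * ‖w‖ ^ 2 ≤ μ.real D) (hSw : ∀ t ∈ D, 1 ≤ |S w t|) : IsSpreadOn S C (A ∪ D) := by
  obtain ⟨hAm, ι, _, _, v, hv, hS⟩ := hA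
  refine ⟨hAm.union hD, ι × Bool, inferInstance, inferInstance,
    fun p => if p.2 then v p.1 + w else v p.1 - w, ?_, ?_⟩
  · have h1 : ∀ i, ‖v i + w‖ ^ 2 + ‖v i - w‖ ^ 2 = 2 * (‖v i‖ ^ 2 + ‖w‖ ^ 2) := fun i => by
      have := parallelogram_law_with_norm ℝ (v i) w
      simp only [sq]
      linarith
    rw [Fintype.sum_prod_type, measureReal_union hAD hD]
    simp only [Fintype.sum_bool, if_true, Bool.false_eq_true, if_false, h1, Fintype.card_prod,
      Fintype.card_bool, Nat.cast_mul, ← Finset.mul_sum, Finset.sum_add_distrib, Finset.sum_const,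
      Finset.card_univ, nsmul_eq_mul]
    have : (Fintype.card ι : ℝ) * (C * ‖w‖ ^ 2) ≤ Fintype.card ι * μ.real D := by gcongr
    push_cast
    linarith
  · have hadd : ∀ᵐ t ∂μ, ∀ i, S (v i + w) t = S (v i) t + S w t ∧
        S (v i - w) t = S (v i) t - S w t := by
      rw [ae_all_iff]
      intro i
      rw [map_add, map_sub]
      filter_upwards [AEEqFun.coeFn_add (S (v i)) (S w), AEEqFun.coeFn_sub (S (v i)) (S w)]
        with t h1 h2
      exact ⟨h1, h2⟩
    filter_upwards [hS, hadd] with t h1 h2 ht b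
    rw [Fintype.sum_prod_type]
    simp only [Fintype.sum_bool, if_true, Bool.false_eq_true, if_false, h2, Fintype.card_prod,
      Fintype.card_bool, Nat.cast_mul, Finset.sum_add_distrib]
    push_cast
    -- On `A` the terms `± S w t` are absorbed into the arbitrary translation `b`. On `D` each pair
    -- `v i ± w` has a large member, because the two values differ by `2 * S w t`.
    rcases ht with ht | ht
    · have e1 := h1 ht (S w t + b)
      have e2 := h1 ht (-S w t + b)
      simp only [← add_assoc, ← sub_eq_add_neg] at e1 e2
      linarith
    · have : (Fintype.card ι : ℝ) ≤ ∑ i, (Set.indicator {x : ℝ | 1 ≤ |x|} 1 (S (v i) t + S w t + b) +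
          Set.indicator {x : ℝ | 1 ≤ |x|} 1 (S (v i) t - S w t + b)) := by
        have e : (Fintype.card ι : ℝ) = ∑ _i : ι, (1 : ℝ) := by simp
        rw [e]
        refine Finset.sum_le_sum fun i _ => ?_
        rw [add_right_comm, sub_add_eq_add_sub]
        exact one_le_indicator_add_indicator (hSw t ht)
      rw [Finset.sum_add_distrib] at this
      linarith

theorem measurableSet_one_le_abs (f : T →ₘ[μ] ℝ) : MeasurableSet {t | 1 ≤ |f t|} :=
  measurableSet_le measurable_const f.measurable.abs

/-- Averaging `hK` over the family bounds the mean probability of a large image by `ε + μ A / 4`,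
while spreading makes it at least `μ A / 2`. -/
theorem IsSpreadOn.measureReal_le [IsProbabilityMeasure μ] {S : V →ₗ[ℝ] (T →ₘ[μ] ℝ)}
    {ε K : ℝ} {A : Set T} (hK : ∀ v, μ.real {t | 1 ≤ |S v t|} ≤ ε + K * ‖v‖ ^ 2)
    (hA : IsSpreadOn S (4 * K) A) : μ.real A ≤ 4 * ε := by
  obtain ⟨hAm, ι, _, _, v, hv, hS⟩ := hA
  have hm : ∀ i, MeasurableSet {t | 1 ≤ |S (v i) t|} := fun i => measurableSet_one_le_abs _
  have h1 : ∫ t, A.indicator (fun _ => (Fintype.card ι : ℝ)) t ∂μ ≤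
      ∫ t, 2 * ∑ i, Set.indicator {t | 1 ≤ |S (v i) t|} (fun _ => (1 : ℝ)) t ∂μ := by
    refine integral_mono_ae ((integrable_const _).indicator hAm) ?_ ?_
    · exact (integrable_finsetSum _ fun i _ => (integrable_const _).indicator (hm i)).const_mul _
    · filter_upwards [hS] with t ht
      by_cases htA : t ∈ A
      · have := ht htA 0
        simp only [add_zero] at this
        rw [Set.indicator_of_mem htA]
        exact this
      · rw [Set.indicator_of_notMem htA]
        exact mul_nonneg zero_le_two (Finset.sum_nonneg fun i _ =>
          Set.indicator_nonneg (fun _ _ => zero_le_one) _)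
  rw [integral_indicator_const _ hAm, integral_const_mul,
    integral_finsetSum _ fun i _ => (integrable_const _).indicator (hm i)] at h1
  simp only [integral_indicator_const _ (hm _), smul_eq_mul, mul_one] at h1
  have h2 : ∑ i, μ.real {t | 1 ≤ |S (v i) t|} ≤ ∑ i, (ε + K * ‖v i‖ ^ 2) :=
    Finset.sum_le_sum fun i _ => hK _
  rw [Finset.sum_add_distrib, ← Finset.mul_sum, Finset.sum_const, Finset.card_univ,
    nsmul_eq_mul] at h2
  have hc : (0 : ℝ) < Fintype.card ι := by exact_mod_cast Fintype.card_pos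
  have h3 : (Fintype.card ι : ℝ) * μ.real A ≤ Fintype.card ι * (4 * ε) := by linarith
  exact le_of_mul_le_mul_left h3 hc

/-- An operator from a Hilbert space, bounded in probability, is of weak type `(2, 2)` on sets of
almost full measure. -/
theorem exists_set_weak_type [IsProbabilityMeasure μ] (S : V →ₗ[ℝ] (T →ₘ[μ] ℝ)) {ε K : ℝ}
    (hK0 : 0 ≤ K) (hK : ∀ v, μ.real {t | 1 ≤ |S v t|} ≤ ε + K * ‖v‖ ^ 2) :
    ∃ B : Set T, MeasurableSet B ∧ μ.real Bᶜ ≤ 4 * ε ∧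
      ∀ v, μ.real (B ∩ {t | 1 ≤ |S v t|}) ≤ 4 * K * ‖v‖ ^ 2 := by
  obtain ⟨B, hB, hBc, hmax⟩ := exists_measurableSet_exhaustion (μ := μ)
    (G := IsSpreadOn S (4 * K)) (fun A h => h.1) (isSpreadOn_empty S _)
    (fun A hA => hA.measureReal_le hK)
  refine ⟨B, hB, hBc, fun v => ?_⟩
  by_contra! h
  have hD := hB.inter (measurableSet_one_le_abs (S v))
  -- A set violating the weak type bound could be adjoined to every spread set disjoint from it, so
  -- it would be null.
  have h0 := hmax _ hD Set.inter_subset_left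
    fun A hA hdis => hA.union hD hdis h.le fun t ht => ht.2
  have : 0 ≤ 4 * K * ‖v‖ ^ 2 := by positivity
  linarith

/-- Layer-cake formula: the tail at height `x` is at most `1`, and at most `C / x ^ 2` by the weak
bound at `x⁻¹ • v`; together these give the integrable majorant `(1 + C) / (1 + x ^ 2)`. -/
theorem lintegral_enorm_le_of_weak_type [IsProbabilityMeasure μ] (S : V →ₗ[ℝ] (T →ₘ[μ] ℝ))
    {B : Set T} {C : ℝ} (hC : 0 ≤ C)
    (hB : ∀ v, μ.real (B ∩ {t | 1 ≤ |S v t|}) ≤ C * ‖v‖ ^ 2) {v : V} (hv : ‖v‖ ≤ 1) :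
    ∫⁻ t in B, ‖S v t‖ₑ ∂μ ≤ ∫⁻ x : ℝ, ENNReal.ofReal ((1 + C) * (1 + x ^ 2)⁻¹) := by
  have e : ∀ t, ‖S v t‖ₑ = ENNReal.ofReal |S v t| := fun t => Real.enorm_eq_ofReal_abs _
  simp_rw [e]
  rw [lintegral_eq_lintegral_meas_le _ (Eventually.of_forall fun t => abs_nonneg _)
    (S v).measurable.abs.aemeasurable]
  refine (setLIntegral_mono' measurableSet_Ioi fun x hx => ?_).trans (setLIntegral_le_lintegral _ _)
  have hx : 0 < x := hx
  have hm : MeasurableSet {t | x ≤ |S v t|} := measurableSet_le measurable_const (S v).measurable.abs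
  rw [Measure.restrict_apply hm, Set.inter_comm,
    ← ENNReal.ofReal_toReal (measure_ne_top μ (B ∩ {t | x ≤ |S v t|}))]
  refine ENNReal.ofReal_le_ofReal ?_
  have h1 : μ.real (B ∩ {t | x ≤ |S v t|}) ≤ C * ‖x⁻¹ • v‖ ^ 2 := by
    refine le_trans (le_of_eq ?_) (hB (x⁻¹ • v))
    refine measureReal_congr ?_
    rw [map_smul]
    filter_upwards [AEEqFun.coeFn_smul x⁻¹ (S v)] with t ht
    refine congrArg (fun p : Prop => (t ∈ B ∧ p)) (propext ?_)
    change x ≤ |S v t| ↔ 1 ≤ |(x⁻¹ • S v : T →ₘ[μ] ℝ) t|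
    rw [ht, Pi.smul_apply, smul_eq_mul, abs_mul, abs_of_pos (inv_pos.2 hx),
      ← div_eq_inv_mul, one_le_div hx]
  have h2 : μ.real (B ∩ {t | x ≤ |S v t|}) ≤ 1 := measureReal_le_one
  change μ.real _ ≤ _
  rw [norm_smul, norm_inv, Real.norm_eq_abs, abs_of_pos hx, mul_pow] at h1
  have h3 : x ^ 2 * μ.real (B ∩ {t | x ≤ |S v t|}) ≤ C := by
    calc x ^ 2 * μ.real (B ∩ {t | x ≤ |S v t|}) ≤ x ^ 2 * (C * (x⁻¹ ^ 2 * ‖v‖ ^ 2)) := by gcongr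
      _ = C * ‖v‖ ^ 2 := by field_simp
      _ ≤ C * 1 := by gcongr; exact pow_le_one₀ (norm_nonneg _) hv
      _ = C := mul_one _
  rw [← div_eq_mul_inv, le_div_iff₀ (by positivity)]
  linarith

/-- **Change of density.** A linear operator from a Hilbert space to `L⁰(μ)` which is bounded in
probability becomes bounded into `L¹` after passing to an equivalent probability measure. -/
theorem exists_equivalent_measure_bound [IsProbabilityMeasure μ] (S : V →ₗ[ℝ] (T →ₘ[μ] ℝ))
    (hS : ∀ ε > 0, ∃ K : ℝ, ∀ v, μ.real {t | 1 ≤ |S v t|} ≤ ε + K * ‖v‖ ^ 2) :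
    ∃ μ' : Measure T, IsProbabilityMeasure μ' ∧ μ' ≪ μ ∧ μ ≪ μ' ∧
      ∃ M : NNReal, ∀ v, ‖v‖ ≤ 1 → ∫⁻ t, ‖S v t‖ₑ ∂μ' ≤ M := by
  have key : ∀ m : ℕ, ∃ (B : Set T) (C : NNReal), MeasurableSet B ∧ μ.real Bᶜ ≤ 1 / ((m : ℝ) + 1) ∧
      ∀ v, ‖v‖ ≤ 1 → ∫⁻ t in B, ‖S v t‖ₑ ∂μ ≤ C := by
    intro m
    -- The division by `4` offsets the bound `4 * ε` on the complement of the good set.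
    obtain ⟨K, hK⟩ := hS (1 / ((m : ℝ) + 1) / 4) (by positivity)
    have hK' : ∀ v, μ.real {t | 1 ≤ |S v t|} ≤ 1 / ((m : ℝ) + 1) / 4 + |K| * ‖v‖ ^ 2 := fun v =>
      (hK v).trans (by gcongr; exact le_abs_self K)
    obtain ⟨B, hB, hBc, hw⟩ := exists_set_weak_type S (abs_nonneg K) hK'
    have hfin : ∫⁻ x : ℝ, ENNReal.ofReal ((1 + 4 * |K|) * (1 + x ^ 2)⁻¹) ≠ ⊤ :=
      ((integrable_inv_one_add_sq.const_mul _).lintegral_lt_top).ne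
    refine ⟨B, (∫⁻ x : ℝ, ENNReal.ofReal ((1 + 4 * |K|) * (1 + x ^ 2)⁻¹)).toNNReal, hB,
      hBc.trans (by linarith), fun v hv => ?_⟩
    rw [ENNReal.coe_toNNReal hfin]
    exact lintegral_enorm_le_of_weak_type S (by positivity) hw hv
  choose B C hB hBc hC using key
  -- These weights make both the total mass of the density `ρ` and the sum of the `L¹` bounds over
  -- the sets `B m` at most `∑ 2⁻ᵐ`.
  let a : ℕ → NNReal := fun m => (1 / 2) ^ m / (1 + C m)
  have ha : ∀ m, 0 < a m := fun m => by positivity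
  have haC : ∀ m, a m * C m ≤ (1 / 2) ^ m := fun m => by
    have : C m / (1 + C m) ≤ 1 := div_le_one_of_le₀ (by simp) zero_le
    calc a m * C m = (1 / 2) ^ m * (C m / (1 + C m)) := by simp only [a]; ring
      _ ≤ (1 / 2) ^ m * 1 := by gcongr
      _ = _ := mul_one _
  have ha1 : ∀ m, a m ≤ (1 / 2) ^ m := fun m => div_le_self zero_le (by simp)
  have hgeom : ∑' m : ℕ, (((1 / 2) ^ m : NNReal) : ENNReal) ≤ 2 := by
    have : ∀ m : ℕ, (((1 / 2) ^ m : NNReal) : ENNReal) = (2⁻¹ : ENNReal) ^ m := fun m => by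
      rw [ENNReal.coe_pow]
      congr 1
      rw [one_div, ENNReal.coe_inv two_ne_zero, ENNReal.coe_ofNat]
    simp_rw [this]
    rw [ENNReal.tsum_geometric, ENNReal.one_sub_inv_two, inv_inv]
  let ρ : T → ENNReal := fun t => ∑' m, (B m).indicator (fun _ => (a m : ENNReal)) t
  have hρm : Measurable ρ := Measurable.tsum fun m => measurable_const.indicator (hB m)
  have hint : ∀ f : T → ENNReal, Measurable f →
      ∫⁻ t, f t ∂(μ.withDensity ρ) = ∑' m, (a m : ENNReal) * ∫⁻ t in B m, f t ∂μ := by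
    intro f hf
    rw [lintegral_withDensity_eq_lintegral_mul _ hρm hf]
    simp only [Pi.mul_apply, ρ, ← ENNReal.tsum_mul_right]
    rw [lintegral_tsum (f := fun m t => (B m).indicator (fun _ => (a m : ENNReal)) t * f t)
      fun m => ((measurable_const.indicator (hB m)).mul hf).aemeasurable]
    refine tsum_congr fun m => ?_
    rw [← lintegral_const_mul _ hf, ← lintegral_indicator (hB m)]
    refine lintegral_congr fun t => ?_
    by_cases ht : t ∈ B m <;> simp [ht]
  -- The density vanishes only outside every `B m`, and the complements have measure tending to
  -- zero.
  have hpos : ∀ᵐ t ∂μ, ρ t ≠ 0 := by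
    have h0 : μ (⋂ m, (B m)ᶜ) = 0 := by
      rw [← measureReal_eq_zero_iff]
      refine le_antisymm (ge_of_tendsto' (tendsto_one_div_add_atTop_nhds_zero_nat (𝕜 := ℝ))
        fun m => ?_) measureReal_nonneg
      exact (measureReal_mono (Set.iInter_subset _ m)).trans (hBc m)
    rw [ae_iff]
    refine measure_mono_null (fun t ht => ?_) h0
    simp only [ne_eq, not_not, Set.mem_ofPred_eq, ρ, ENNReal.tsum_eq_zero] at ht
    refine Set.mem_iInter.2 fun m hm => ?_
    have := ht m
    rw [Set.indicator_of_mem hm] at this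
    exact (ha m).ne' (by exact_mod_cast this)
  have hac1 : μ.withDensity ρ ≪ μ := withDensity_absolutelyContinuous μ ρ
  have hac2 : μ ≪ μ.withDensity ρ := withDensity_absolutelyContinuous' hρm.aemeasurable hpos
  set c : ENNReal := (μ.withDensity ρ) Set.univ with hc
  have hc0 : c ≠ 0 := fun h => by
    have := hac2 h
    simp at this
  have hctop : c ≠ ⊤ := by
    have h1 : c = ∑' m, (a m : ENNReal) * ∫⁻ t in B m, 1 ∂μ := by
      rw [← hint _ measurable_const, lintegral_one]
    have h2 : c ≤ 2 := by
      rw [h1]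
      refine le_trans (ENNReal.tsum_le_tsum fun m => ?_) hgeom
      calc (a m : ENNReal) * ∫⁻ t in B m, 1 ∂μ ≤ a m * 1 := by
            gcongr
            rw [setLIntegral_one]
            exact prob_le_one
        _ ≤ _ := by rw [mul_one]; exact_mod_cast ha1 m
    exact (h2.trans_lt (by simp)).ne
  have hcinv : c⁻¹ ≠ 0 := ENNReal.inv_ne_zero.2 hctop
  refine ⟨c⁻¹ • μ.withDensity ρ, ⟨?_⟩, (Measure.smul_absolutelyContinuous).trans hac1,
    hac2.trans (Measure.absolutelyContinuous_smul hcinv), (c⁻¹ * 2).toNNReal, fun v hv => ?_⟩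
  · rw [Measure.smul_apply, smul_eq_mul, ← hc, ENNReal.inv_mul_cancel hc0 hctop]
  · rw [ENNReal.coe_toNNReal (ENNReal.mul_ne_top (ENNReal.inv_ne_top.2 hc0) (by simp)),
      lintegral_smul_measure, smul_eq_mul, hint _ (S v).measurable.enorm]
    gcongr
    refine le_trans (ENNReal.tsum_le_tsum fun m => ?_) hgeom
    calc (a m : ENNReal) * ∫⁻ t in B m, ‖S v t‖ₑ ∂μ ≤ a m * C m := by gcongr; exact hC m v hv
      _ ≤ _ := by exact_mod_cast haC m

end ChangeOfDensity

/-! ### Products of independent copies of a standard Gaussian -/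

namespace GeneralizedFunction

variable {H : Type*} [NormedAddCommGroup H] [InnerProductSpace ℝ H]
  {Ω : Type*} [MeasurableSpace Ω] {P : Measure Ω}

theorem ae_apply_sum_smul (X : GeneralizedFunction H P) {κ : Type*} (s : Finset κ) (c : κ → ℝ)
    (h : κ → H) : ∀ᵐ ω ∂P, X (∑ k ∈ s, c k • h k) ω = ∑ k ∈ s, c k * X (h k) ω := by
  classical
  induction s using Finset.induction_on with
  | empty =>
    have h0 : X (0 : H) = 0 := map_zero X.toLinearMap
    simp only [Finset.sum_empty, h0]
    exact AEEqFun.coeFn_zero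
  | insert a s ha ih =>
    have h1 : X (∑ k ∈ insert a s, c k • h k) = c a • X (h a) + X (∑ k ∈ s, c k • h k) := by
      rw [Finset.sum_insert ha]
      exact (map_add X.toLinearMap _ _).trans (congrArg (· + _) (map_smul X.toLinearMap _ _))
    rw [h1]
    filter_upwards [ih, AEEqFun.coeFn_add (c a • X (h a)) (X (∑ k ∈ s, c k • h k)),
      AEEqFun.coeFn_smul (c a) (X (h a))] with ω e1 e2 e3
    rw [e2, Pi.add_apply, e3, e1, Finset.sum_insert ha, Pi.smul_apply, smul_eq_mul]

theorem IsStandardGaussian.memLp_two {X : GeneralizedFunction H P} (hX : X.IsStandardGaussian)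
    (ξ : H) : MemLp (X ξ) 2 P := by
  have h : MemLp id 2 (P.map (X ξ)) := by
    rw [(hX ξ).map_eq]
    exact memLp_id_gaussianReal 2
  exact (memLp_map_measure_iff h.1 (X ξ).measurable.aemeasurable).1 h

theorem IsStandardGaussian.integral_sq [IsProbabilityMeasure P] {X : GeneralizedFunction H P}
    (hX : X.IsStandardGaussian) (ξ : H) : ∫ ω, X ξ ω ^ 2 ∂P = ‖ξ‖ ^ 2 := by
  have h0 : ∫ ω, X ξ ω ∂P = 0 := by
    rw [(hX ξ).integral_eq]
    simp
  rw [← variance_of_integral_eq_zero (X ξ).measurable.aemeasurable h0, (hX ξ).variance_eq]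
  simp

theorem IsStandardGaussian.integral_mul [IsProbabilityMeasure P] {X : GeneralizedFunction H P}
    (hX : X.IsStandardGaussian) (ξ η : H) : ∫ ω, X ξ ω * X η ω ∂P = ⟪ξ, η⟫ := by
  have h1 : X (ξ + η) = X ξ + X η := map_add X.toLinearMap _ _
  have h2 : ∫ ω, X (ξ + η) ω ^ 2 ∂P =
      ∫ ω, X ξ ω ^ 2 + (2 * (X ξ ω * X η ω) + X η ω ^ 2) ∂P := by
    refine integral_congr_ae ?_
    rw [h1]
    filter_upwards [AEEqFun.coeFn_add (X ξ) (X η)] with ω e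
    rw [e, Pi.add_apply]
    ring
  have i1 := (hX.memLp_two ξ).integrable_sq
  have i2 := (hX.memLp_two η).integrable_sq
  have i3 : Integrable (fun ω => X ξ ω * X η ω) P :=
    (hX.memLp_two ξ).integrable_mul (hX.memLp_two η)
  have i4 : Integrable (fun ω => 2 * (X ξ ω * X η ω) + X η ω ^ 2) P := (i3.const_mul 2).add i2
  rw [integral_add i1 i4, integral_add (i3.const_mul 2) i2, integral_const_mul, hX.integral_sq, hX.integral_sq, hX.integral_sq, norm_add_sq_real] at h2
  linarith

theorem IsStandardGaussian.integral_exp [IsProbabilityMeasure P] {X : GeneralizedFunction H P}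
    (hX : X.IsStandardGaussian) (ξ : H) :
    ∫ ω, Complex.exp (X ξ ω * Complex.I) ∂P = Complex.exp (-(‖ξ‖ ^ 2 / 2 : ℝ)) := by
  have h := charFun_gaussianReal (μ := 0) (v := ‖ξ‖₊ ^ 2) 1
  rw [← (hX ξ).map_eq, charFun_apply_real, integral_map (X ξ).measurable.aemeasurable
    (by fun_prop)] at h
  simp only [Complex.ofReal_one, one_mul] at h
  rw [h]
  congr 1
  push_cast
  simp

/-! ### Rotation invariance of independent copies -/

variable {ι κ : Type*} [Fintype ι]

/-- The linear images, by the matrix `O`, of the values at `h` of independent copies of `X`. -/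
def copies (X : GeneralizedFunction H P) (O : Matrix ι ι ℝ) (h : κ → H) (ω : ι → Ω) : ι × κ → ℝ :=
  fun p => ∑ j, O p.1 j * X (h p.2) (ω j)

theorem measurable_copies (X : GeneralizedFunction H P) (O : Matrix ι ι ℝ) (h : κ → H) :
    Measurable (X.copies O h) :=
  measurable_pi_iff.2 fun p => Finset.measurable_sum _ fun j _ =>
    ((X (h p.2)).measurable.comp (measurable_pi_apply j)).const_mul _

variable [Fintype κ]

theorem sum_norm_sq_eq (O : Matrix ι ι ℝ) (h : κ → H) (l : ι × κ → ℝ) :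
    ∑ j, ‖∑ p : ι × κ, (l p * O p.1 j) • h p.2‖ ^ 2 =
      ∑ p : ι × κ, ∑ q : ι × κ, l p * l q * (O * O.transpose) p.1 q.1 * ⟪h p.2, h q.2⟫ := by
  simp_rw [← real_inner_self_eq_norm_sq, sum_inner, inner_sum, real_inner_smul_left,
    real_inner_smul_right, Matrix.mul_apply, Matrix.transpose_apply, Finset.mul_sum,
    Finset.sum_mul]
  rw [Finset.sum_comm]
  refine Finset.sum_congr rfl fun p _ => ?_
  rw [Finset.sum_comm]
  refine Finset.sum_congr rfl fun q _ => Finset.sum_congr rfl fun j _ => ?_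
  ring

/-- By linearity of `X`, a functional of the array is a sum over `j` of `X (u j)` at the `j`-th
copy, so the one-dimensional Gaussian laws and independence suffice. The matrix enters only through
`O * Oᵀ`. -/
theorem IsStandardGaussian.charFunDual_copies [IsProbabilityMeasure P]
    {X : GeneralizedFunction H P} (hX : X.IsStandardGaussian) [DecidableEq ι] [DecidableEq κ]
    (O : Matrix ι ι ℝ) (h : κ → H) (L : StrongDual ℝ (ι × κ → ℝ)) :
    charFunDual ((Measure.pi fun _ : ι => P).map (X.copies O h)) L =
      Complex.exp (-((∑ p : ι × κ, ∑ q : ι × κ, L (Pi.single p 1) * L (Pi.single q 1) *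
        (O * O.transpose) p.1 q.1 * ⟪h p.2, h q.2⟫) / 2 : ℝ)) := by
  set l : ι × κ → ℝ := fun p => L (Pi.single p 1) with hl
  set u : ι → H := fun j => ∑ p : ι × κ, (l p * O p.1 j) • h p.2 with hu
  have hLw : ∀ w : ι × κ → ℝ, L w = ∑ p, w p * l p := fun w => by
    conv_lhs => rw [pi_eq_sum_univ' w]
    simp only [map_sum, map_smul, smul_eq_mul, hl]
  have hae : ∀ᵐ ω ∂(Measure.pi fun _ : ι => P),
      Complex.exp (L (X.copies O h ω) * Complex.I) =
        ∏ j, Complex.exp (X (u j) (ω j) * Complex.I) := by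
    have h1 : ∀ᵐ ω ∂(Measure.pi fun _ : ι => P), ∀ j,
        X (u j) (ω j) = ∑ p : ι × κ, (l p * O p.1 j) * X (h p.2) (ω j) := by
      rw [ae_all_iff]
      intro j
      exact (measurePreserving_eval (fun _ : ι => P) j).quasiMeasurePreserving.ae
        (X.ae_apply_sum_smul Finset.univ (fun p : ι × κ => l p * O p.1 j) (fun p => h p.2))
    filter_upwards [h1] with ω hω
    rw [← Complex.exp_sum, ← Finset.sum_mul, ← Complex.ofReal_sum]
    congr 3
    simp_rw [hω, hLw, copies, Finset.sum_mul]
    rw [Finset.sum_comm]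
    refine Finset.sum_congr rfl fun j _ => Finset.sum_congr rfl fun p _ => ?_
    ring
  rw [charFunDual_apply, integral_map (X.measurable_copies O h).aemeasurable (by fun_prop),
    integral_congr_ae hae,
    integral_fintype_prod_eq_prod (fun j ω => Complex.exp (X (u j) ω * Complex.I))]
  simp_rw [hX.integral_exp]
  rw [← Complex.exp_sum, ← sum_norm_sq_eq]
  congr 1
  push_cast
  rw [Finset.sum_neg_distrib, Finset.sum_div]

/-- The joint law of independent copies of a standard Gaussian is invariant under rotations. -/
theorem IsStandardGaussian.map_copies_eq [IsProbabilityMeasure P]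
    {X : GeneralizedFunction H P} (hX : X.IsStandardGaussian) {O O' : Matrix ι ι ℝ}
    (hO : O * O.transpose = O' * O'.transpose) (h : κ → H) :
    (Measure.pi fun _ : ι => P).map (X.copies O h) =
      (Measure.pi fun _ : ι => P).map (X.copies O' h) := by
  classical
  have := Measure.isProbabilityMeasure_map (μ := Measure.pi fun _ : ι => P)
    (X.measurable_copies O h).aemeasurable
  have := Measure.isProbabilityMeasure_map (μ := Measure.pi fun _ : ι => P)
    (X.measurable_copies O' h).aemeasurable
  refine Measure.ext_of_charFunDual (funext fun L => ?_)
  rw [hX.charFunDual_copies, hX.charFunDual_copies, hO]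

theorem IsStandardGaussian.measure_preimage_copies_eq [IsProbabilityMeasure P]
    {X : GeneralizedFunction H P} (hX : X.IsStandardGaussian) {O O' : Matrix ι ι ℝ}
    (hO : O * O.transpose = O' * O'.transpose) (h : κ → H) {E : Set (ι × κ → ℝ)}
    (hE : MeasurableSet E) :
    (Measure.pi fun _ : ι => P) (X.copies O h ⁻¹' E) =
      (Measure.pi fun _ : ι => P) (X.copies O' h ⁻¹' E) := by
  rw [← Measure.map_apply (X.measurable_copies O h) hE,
    ← Measure.map_apply (X.measurable_copies O' h) hE, hX.map_copies_eq hO]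

/-! ### Decoupled multilinear expressions in the copies -/

/-- The set of arrays at which a multilinear expression, translated by `y`, is at least `1`. -/
def largeSet (c : κ → ℝ) (y : κ → ι → ℝ) : Set (ι × (κ × ι) → ℝ) :=
  {w | 1 ≤ |∑ k, c k * ∏ i, (y k i + w (i, (k, i)))|}

theorem measurableSet_largeSet (c : κ → ℝ) (y : κ → ι → ℝ) : MeasurableSet (largeSet c y) := by
  refine measurableSet_le measurable_const ?_
  fun_prop

theorem integrable_prod_copies [IsProbabilityMeasure P] {X : GeneralizedFunction H P}
    (hX : X.IsStandardGaussian) (ξ η : ι → H) :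
    Integrable (fun ω : ι → Ω => (∏ i, X (ξ i) (ω i)) * ∏ i, X (η i) (ω i))
      (Measure.pi fun _ : ι => P) := by
  simp_rw [← Finset.prod_mul_distrib]
  exact Integrable.fintype_prod (f := fun i ω => X (ξ i) ω * X (η i) ω) fun i =>
    (hX.memLp_two (ξ i)).integrable_mul (hX.memLp_two (η i))

theorem IsStandardGaussian.integral_sq_sum_prod [IsProbabilityMeasure P]
    {X : GeneralizedFunction H P} (hX : X.IsStandardGaussian) {n : ℕ} (c : κ → ℝ)
    (m : κ → Fin n → H) :
    Integrable (fun ω : Fin n → Ω => (∑ k, c k * ∏ i, X (m k i) (ω i)) ^ 2)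
      (Measure.pi fun _ : Fin n => P) ∧
    ∫ ω, (∑ k, c k * ∏ i, X (m k i) (ω i)) ^ 2 ∂(Measure.pi fun _ : Fin n => P) =
      ‖∑ k, c k • AlgTensorPower.pure (m k)‖ ^ 2 := by
  have e : ∀ ω : Fin n → Ω, (∑ k, c k * ∏ i, X (m k i) (ω i)) ^ 2 =
      ∑ k, ∑ l, c k * c l * ((∏ i, X (m k i) (ω i)) * ∏ i, X (m l i) (ω i)) := fun ω => by
    rw [sq, Finset.sum_mul_sum]
    refine Finset.sum_congr rfl fun k _ => Finset.sum_congr rfl fun l _ => ?_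
    ring
  have hi : ∀ k l, Integrable (fun ω : Fin n → Ω =>
      c k * c l * ((∏ i, X (m k i) (ω i)) * ∏ i, X (m l i) (ω i)))
      (Measure.pi fun _ : Fin n => P) := fun k l => (integrable_prod_copies hX _ _).const_mul _
  simp_rw [e]
  refine ⟨integrable_finsetSum _ fun k _ => integrable_finsetSum _ fun l _ => hi k l, ?_⟩
  rw [integral_finsetSum _ fun k _ => integrable_finsetSum _ fun l _ => hi k l,
    ← real_inner_self_eq_norm_sq]
  simp_rw [sum_inner, inner_sum, real_inner_smul_left, real_inner_smul_right,
    AlgTensorPower.inner_pure]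
  refine Finset.sum_congr rfl fun k _ => ?_
  rw [integral_finsetSum _ fun l _ => hi k l]
  refine Finset.sum_congr rfl fun l _ => ?_
  rw [integral_const_mul]
  simp_rw [← Finset.prod_mul_distrib]
  rw [integral_fintype_prod_eq_prod (fun i ω => X (m k i) ω * X (m l i) ω)]
  simp_rw [hX.integral_mul]
  ring

/-- Rotation invariance reduces to `O = 1`, where Chebyshev applies to the second moment. -/
theorem IsStandardGaussian.measureReal_preimage_largeSet_le [IsProbabilityMeasure P]
    {X : GeneralizedFunction H P} (hX : X.IsStandardGaussian) {n : ℕ}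
    {O : Matrix (Fin n) (Fin n) ℝ} (hO : O * O.transpose = 1) (c : κ → ℝ) (m : κ → Fin n → H) :
    (Measure.pi fun _ : Fin n => P).real
        (X.copies O (fun p : κ × Fin n => m p.1 p.2) ⁻¹' largeSet c 0) ≤
      ‖∑ k, c k • AlgTensorPower.pure (m k)‖ ^ 2 := by
  have hO' : O * O.transpose = (1 : Matrix (Fin n) (Fin n) ℝ) * (1 : Matrix _ _ ℝ).transpose := by
    simpa using hO
  rw [measureReal_def, hX.measure_preimage_copies_eq hO' _ (measurableSet_largeSet c 0),
    ← measureReal_def]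
  obtain ⟨hi, he⟩ := hX.integral_sq_sum_prod c m
  have h := mul_meas_ge_le_integral_of_nonneg (Eventually.of_forall fun ω => sq_nonneg _) hi 1
  rw [one_mul, he] at h
  refine le_trans (measureReal_mono fun ω hω => ?_) h
  have h1 : 1 ≤ |∑ k, c k * ∏ i, X (m k i) (ω i)| := by
    simpa [largeSet, copies, Matrix.one_apply] using hω
  change 1 ≤ (∑ k, c k * ∏ i, X (m k i) (ω i)) ^ 2
  rw [← sq_abs]
  exact one_le_pow₀ h1

theorem sum_signs_prod (x y : ι → ℝ) [DecidableEq ι] :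
    ∑ σ : ι → Bool, ∏ i, (y i + (if σ i then 1 else -1) * x i) =
      2 ^ Fintype.card ι * ∏ i, y i := by
  rw [← Fintype.prod_sum (fun i (b : Bool) => y i + (if b then 1 else -1) * x i)]
  simp only [Fintype.sum_bool, if_true, Bool.false_eq_true, if_false]
  rw [← Finset.card_univ, ← Finset.prod_const, ← Finset.prod_mul_distrib]
  refine Finset.prod_congr rfl fun i _ => ?_
  ring

/-- Sign changes of the copies preserve their law, and the mean over signs of the shifted expression
is its value at `y`. So at every point some sign pattern gives a large value: the `2 ^ n`
equiprobable events cover the space. -/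
theorem IsStandardGaussian.one_le_measure_preimage_largeSet [IsProbabilityMeasure P]
    {X : GeneralizedFunction H P} (hX : X.IsStandardGaussian) {n : ℕ}
    {O : Matrix (Fin n) (Fin n) ℝ} (hO : O * O.transpose = 1) (c : κ → ℝ) (m : κ → Fin n → H)
    (y : κ → Fin n → ℝ) (hy : 1 ≤ |∑ k, c k * ∏ i, y k i|) :
    1 ≤ 2 ^ n * (Measure.pi fun _ : Fin n => P)
        (X.copies O (fun p : κ × Fin n => m p.1 p.2) ⁻¹' largeSet c y) := by
  let D : (Fin n → Bool) → Matrix (Fin n) (Fin n) ℝ :=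
    fun σ => Matrix.diagonal fun i => if σ i then 1 else -1
  have hD : ∀ σ, O * O.transpose = D σ * (D σ).transpose := fun σ => by
    rw [hO, Matrix.diagonal_transpose, Matrix.diagonal_mul_diagonal, ← Matrix.diagonal_one]
    congr 1
    funext i
    split_ifs <;> simp
  have hU : (⋃ σ, X.copies (D σ) (fun p : κ × Fin n => m p.1 p.2) ⁻¹' largeSet c y) =
      Set.univ := by
    refine Set.eq_univ_of_forall fun ω => ?_
    by_contra hω
    simp only [Set.mem_iUnion, not_exists] at hω
    have h1 : ∀ σ : Fin n → Bool,
        |∑ k, c k * ∏ i, (y k i + (if σ i then 1 else -1) * X (m k i) (ω i))| < 1 := fun σ => by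
      have := hω σ
      simpa [largeSet, copies, D, Matrix.diagonal_apply] using this
    have h2 : ∑ σ : Fin n → Bool,
        ∑ k, c k * ∏ i, (y k i + (if σ i then 1 else -1) * X (m k i) (ω i)) =
          2 ^ n * ∑ k, c k * ∏ i, y k i := by
      rw [Finset.sum_comm, Finset.mul_sum]
      refine Finset.sum_congr rfl fun k _ => ?_
      rw [← Finset.mul_sum, sum_signs_prod, Fintype.card_fin]
      ring
    have h3 : |2 ^ n * ∑ k, c k * ∏ i, y k i| < 2 ^ n := by
      rw [← h2]
      refine (Finset.abs_sum_le_sum_abs _ _).trans_lt ?_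
      calc _ < ∑ _σ : Fin n → Bool, (1 : ℝ) :=
            Finset.sum_lt_sum_of_nonempty Finset.univ_nonempty fun σ _ => h1 σ
        _ = 2 ^ n := by simp
    rw [abs_mul, abs_of_pos (by positivity : (0 : ℝ) < 2 ^ n)] at h3
    have : (2 : ℝ) ^ n * 1 ≤ 2 ^ n * |∑ k, c k * ∏ i, y k i| := by gcongr
    linarith
  calc (1 : ENNReal) = (Measure.pi fun _ : Fin n => P) Set.univ := measure_univ.symm
    _ ≤ ∑ σ, (Measure.pi fun _ : Fin n => P)
        (X.copies (D σ) (fun p : κ × Fin n => m p.1 p.2) ⁻¹' largeSet c y) := by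
      rw [← hU]
      exact measure_iUnion_fintype_le _ _
    _ = _ := by
      simp_rw [← fun σ => hX.measure_preimage_copies_eq (hD σ) (fun p : κ × Fin n => m p.1 p.2)
        (measurableSet_largeSet c y)]
      simp

end GeneralizedFunction

/-! ### Moments of a randomized shift are bounded in probability -/

/-- Either `m₀ S` is below the threshold that forces `m₁ S ≤ ε`, or `K * m₀ S ≥ 1` with `K` the
inverse of the threshold. -/
theorem exists_measureReal_le_add_mul {E : Type*} [MeasurableSpace E] {m₀ m₁ : Measure E}
    [IsProbabilityMeasure m₀] [IsProbabilityMeasure m₁] (h : m₁ ≪ m₀) {ε : ℝ} (hε : 0 < ε) :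
    ∃ K : ℝ, 0 ≤ K ∧ ∀ S, MeasurableSet S → m₁.real S ≤ ε + K * m₀.real S := by
  have hd := Measure.withDensity_rnDeriv_eq m₁ m₀ h
  obtain ⟨δ, hδ, hS⟩ := exists_pos_setLIntegral_lt_of_measure_lt
    (Measure.lintegral_rnDeriv_lt_top m₁ m₀).ne (ENNReal.ofReal_pos.2 hε).ne'
  -- The threshold `δ` may be infinite; the minimum with `1` makes it a positive real.
  have hδ' : min δ 1 ≠ ⊤ := (lt_of_le_of_lt (min_le_right _ _) ENNReal.one_lt_top).ne
  have hpos : 0 < (min δ 1).toReal := ENNReal.toReal_pos (lt_min hδ one_pos).ne' hδ'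
  refine ⟨(min δ 1).toReal⁻¹, by positivity, fun S hSm => ?_⟩
  by_cases hlt : m₀ S < min δ 1
  · have h1 := hS S (hlt.trans_le (min_le_left _ _))
    rw [← withDensity_apply _ hSm, hd] at h1
    have h2 : m₁.real S ≤ ε := ENNReal.toReal_le_of_le_ofReal hε.le h1.le
    have : 0 ≤ (min δ 1).toReal⁻¹ * m₀.real S := by positivity
    linarith
  · have h1 : (min δ 1).toReal ≤ m₀.real S :=
      ENNReal.toReal_mono (measure_ne_top _ _) (not_lt.1 hlt)
    have h2 : m₁.real S ≤ 1 := measureReal_le_one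
    have h3 : 1 ≤ (min δ 1).toReal⁻¹ * m₀.real S := by
      rw [← div_eq_inv_mul, one_le_div hpos]
      exact h1
    linarith

/-- There is an orthogonal matrix with a constant first column. -/
theorem exists_orthogonal_const_column (n : ℕ) :
    ∃ O : Matrix (Fin (n + 1)) (Fin (n + 1)) ℝ, O * O.transpose = 1 ∧
      ∀ i, O i 0 = (√((n : ℝ) + 1))⁻¹ := by
  let u : EuclideanSpace ℝ (Fin (n + 1)) := WithLp.toLp 2 fun _ => (√((n : ℝ) + 1))⁻¹
  have hn : (0 : ℝ) ≤ (n : ℝ) + 1 := by positivity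
  have hu : ‖u‖ = 1 := by
    rw [EuclideanSpace.norm_eq, Real.sqrt_eq_one]
    simp only [u, Real.norm_eq_abs, sq_abs, inv_pow, Real.sq_sqrt hn, Finset.sum_const,
      Finset.card_univ, Fintype.card_fin, nsmul_eq_mul]
    push_cast
    field_simp
  have ho : Orthonormal ℝ (({0} : Set (Fin (n + 1))).domRestrict fun _ => u) := by
    refine ⟨fun _ => hu, fun i j hij => (hij (Subsingleton.elim i j)).elim⟩
  obtain ⟨b, hb⟩ := ho.exists_orthonormalBasis_extension_of_card_eq
    (by simp : Module.finrank ℝ (EuclideanSpace ℝ (Fin (n + 1))) = Fintype.card (Fin (n + 1)))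
  refine ⟨(EuclideanSpace.basisFun (Fin (n + 1)) ℝ).toBasis.toMatrix b, ?_, fun i => ?_⟩
  · have h := OrthonormalBasis.toMatrix_orthonormalBasis_mem_unitary
      (EuclideanSpace.basisFun (Fin (n + 1)) ℝ) b
    have h' := (Matrix.mem_unitaryGroup_iff).1 h
    rwa [Matrix.star_eq_conjTranspose, Matrix.conjTranspose_eq_transpose_of_trivial] at h'
  · rw [Module.Basis.toMatrix_apply, hb 0 rfl]
    simp [u]

/-- Splits off copy `0`, the one that receives the shift. -/
theorem measurePreserving_tail_head {Ω : Type*} [MeasurableSpace Ω] (P : Measure Ω)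
    [IsProbabilityMeasure P] (n : ℕ) :
    MeasurePreserving (fun ω : Fin (n + 1) → Ω => (fun j : Fin n => ω j.succ, ω 0))
      (Measure.pi fun _ => P) ((Measure.pi fun _ : Fin n => P).prod P) :=
  Measure.measurePreserving_swap.comp (measurePreserving_piFinSuccAbove (fun _ => P) 0)

namespace GeneralizedFunction

variable {H : Type*} [NormedAddCommGroup H] [InnerProductSpace ℝ H]
  {Ω : Type*} [MeasurableSpace Ω] {P : Measure Ω} [IsProbabilityMeasure P]
  {T : Type*} [MeasurableSpace T] {μ : Measure T} [IsProbabilityMeasure μ]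

/-- For fixed `t`, the shift of copy `0` moves the `i`-th rotated copy by `O i 0 * Y`, so the sign
argument bounds the section of the event from below; Fubini integrates this over `t`. -/
theorem measure_le_two_pow_mul {X : GeneralizedFunction H P} (hX : X.IsStandardGaussian)
    (Y : GeneralizedFunction H μ) {n : ℕ} {O : Matrix (Fin (n + 1)) (Fin (n + 1)) ℝ}
    (hO : O * O.transpose = 1) {κ : Type*} [Fintype κ] (c : κ → ℝ) (m : κ → Fin (n + 1) → H)
    {S : Set ((Fin n → Ω) × (H → ℝ))} (hSm : MeasurableSet S)
    (hS : S = {q | 1 ≤ |∑ k, c k * ∏ i, (O i 0 * q.2 (m k i) +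
        ∑ j : Fin n, O i j.succ * X (m k i) (q.1 j))|}) :
    μ {t | 1 ≤ |∑ k, c k * ∏ i, O i 0 * Y (m k i) t|} ≤
      2 ^ (n + 1) * ((Measure.pi fun _ : Fin n => P).prod (lawAdd X Y)) S := by
  let κP := Measure.pi fun _ : Fin n => P
  let A : Set (((Fin n → Ω) × Ω) × T) :=
    (fun p => (p.1.1, fun ξ => X ξ p.1.2 + Y ξ p.2)) ⁻¹' S
  have hmap : Measurable fun p : ((Fin n → Ω) × Ω) × T =>
      ((p.1.1, fun ξ => X ξ p.1.2 + Y ξ p.2) : (Fin n → Ω) × (H → ℝ)) :=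
    (measurable_fst.comp measurable_fst).prodMk ((measurable_lawAdd_map X Y).comp
      ((measurable_snd.comp measurable_fst).prodMk measurable_snd))
  have hA : MeasurableSet A := hmap hSm
  have h1 : (κP.prod (lawAdd X Y)) S = ((κP.prod P).prod μ) A := by
    have e1 : κP.prod (lawAdd X Y) = (κP.prod (P.prod μ)).map
        (Prod.map id fun p ξ => X ξ p.1 + Y ξ p.2) := by
      rw [← Measure.map_prod_map _ _ measurable_id (measurable_lawAdd_map X Y), Measure.map_id]
      rfl
    have hm' := (measurable_id : Measurable (id : (Fin n → Ω) → (Fin n → Ω))).prodMap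
      (measurable_lawAdd_map X Y)
    rw [e1, Measure.map_apply hm' hSm,
      ← (measurePreserving_prodAssoc κP P μ).measure_preimage (hm' hSm).nullMeasurableSet]
    rfl
  have h2 : ∀ t, 1 ≤ |∑ k, c k * ∏ i, O i 0 * Y (m k i) t| →
      1 ≤ 2 ^ (n + 1) * (κP.prod P) ((fun x => (x, t)) ⁻¹' A) := by
    intro t ht
    refine (hX.one_le_measure_preimage_largeSet hO c m (fun k i => O i 0 * Y (m k i) t) ht).trans
      (le_of_eq ?_)
    rw [← (measurePreserving_tail_head P n).measure_preimage
      (measurable_prodMk_right hA).nullMeasurableSet]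
    congr 2
    ext ω
    simp only [Set.mem_preimage, A, hS, largeSet, copies, Set.mem_ofPred_eq, Fin.sum_univ_succ,
      mul_add]
    refine iff_of_eq (congrArg (fun x : ℝ => 1 ≤ |x|) (Finset.sum_congr rfl fun k _ => ?_))
    congr 1
    refine Finset.prod_congr rfl fun i _ => ?_
    ring
  have hG : MeasurableSet {t | 1 ≤ |∑ k, c k * ∏ i, O i 0 * Y (m k i) t|} := by
    refine measurableSet_le measurable_const (Measurable.abs ?_)
    exact Finset.measurable_sum _ fun k _ => (Finset.measurable_prod _ fun i _ =>
      (Y (m k i)).measurable.const_mul (O i 0)).const_mul (c k)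
  rw [h1, Measure.prod_apply_symm hA, ← lintegral_const_mul' _ _ (by simp),
    ← lintegral_indicator_one hG]
  refine lintegral_mono fun t => ?_
  by_cases ht : t ∈ {t | 1 ≤ |∑ k, c k * ∏ i, O i 0 * Y (m k i) t|}
  · rw [Set.indicator_of_mem ht]
    exact h2 t ht
  · rw [Set.indicator_of_notMem ht]
    exact zero_le

theorem measure_prod_law_le {X : GeneralizedFunction H P} (hX : X.IsStandardGaussian)
    {n : ℕ} {O : Matrix (Fin (n + 1)) (Fin (n + 1)) ℝ}
    (hO : O * O.transpose = 1) {κ : Type*} [Fintype κ] (c : κ → ℝ) (m : κ → Fin (n + 1) → H)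
    {S : Set ((Fin n → Ω) × (H → ℝ))} (hSm : MeasurableSet S)
    (hS : S = {q | 1 ≤ |∑ k, c k * ∏ i, (O i 0 * q.2 (m k i) +
        ∑ j : Fin n, O i j.succ * X (m k i) (q.1 j))|}) :
    ((Measure.pi fun _ : Fin n => P).prod (law X)).real S ≤
      ‖∑ k, c k • AlgTensorPower.pure (m k)‖ ^ 2 := by
  refine le_trans (le_of_eq ?_) (hX.measureReal_preimage_largeSet_le hO c m)
  have hm' := (measurable_id : Measurable (id : (Fin n → Ω) → (Fin n → Ω))).prodMap
    (measurable_law_map X)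
  have e1 : (Measure.pi fun _ : Fin n => P).prod (law X) =
      ((Measure.pi fun _ : Fin n => P).prod P).map (Prod.map id fun ω ξ => X ξ ω) := by
    rw [← Measure.map_prod_map _ _ measurable_id (measurable_law_map X), Measure.map_id]
    rfl
  rw [measureReal_def, measureReal_def, e1, Measure.map_apply hm' hSm,
    ← (measurePreserving_tail_head P n).measure_preimage (hm' hSm).nullMeasurableSet]
  congr 2
  ext ω
  simp [hS, largeSet, copies, Fin.sum_univ_succ]

/-- The decomposable moments of a randomized shift, up to scaling, are bounded in probability by
the Hilbert–Schmidt norm. -/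
theorem IsRandomizedShift.measureReal_le {X : GeneralizedFunction H P}
    (hX : X.IsStandardGaussian) {Y : GeneralizedFunction H μ} (hY : IsRandomizedShift X Y)
    (n : ℕ) {ε : ℝ} (hε : 0 < ε) :
    ∃ K : ℝ, ∀ (N : ℕ) (c : Fin N → ℝ) (m : Fin N → Fin (n + 1) → H),
      μ.real {t | 1 ≤ |∑ k, c k * ∏ i, (√((n : ℝ) + 1))⁻¹ * Y (m k i) t|} ≤
        ε + K * ‖∑ k, c k • AlgTensorPower.pure (m k)‖ ^ 2 := by
  obtain ⟨O, hO, hO0⟩ := exists_orthogonal_const_column n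
  have hp0 : IsProbabilityMeasure (law X) :=
    Measure.isProbabilityMeasure_map (measurable_law_map X).aemeasurable
  have hp1 : IsProbabilityMeasure (lawAdd X Y) :=
    Measure.isProbabilityMeasure_map (measurable_lawAdd_map X Y).aemeasurable
  have hac : (Measure.pi fun _ : Fin n => P).prod (lawAdd X Y) ≪
      (Measure.pi fun _ : Fin n => P).prod (law X) := Measure.AbsolutelyContinuous.rfl.prod hY
  -- The factor `2 ^ (n + 1)` lost in the sign argument is compensated in advance.
  obtain ⟨K, hK0, hK⟩ := exists_measureReal_le_add_mul hac
    (show 0 < ε / 2 ^ (n + 1) by positivity)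
  refine ⟨2 ^ (n + 1) * K, fun N c m => ?_⟩
  let S : Set ((Fin n → Ω) × (H → ℝ)) := {q | 1 ≤ |∑ k, c k * ∏ i, (O i 0 * q.2 (m k i) +
        ∑ j : Fin n, O i j.succ * X (m k i) (q.1 j))|}
  have hSm : MeasurableSet S := by
    have hx : ∀ (ξ : H) (j : Fin n),
        Measurable fun q : (Fin n → Ω) × (H → ℝ) => X ξ (q.1 j) := fun ξ j =>
      (X ξ).measurable.comp ((measurable_pi_apply j).comp measurable_fst)
    refine measurableSet_le measurable_const ?_
    fun_prop
  have h1 := measure_le_two_pow_mul hX Y hO c m hSm rfl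
  have h2 := measure_prod_law_le hX hO c m hSm rfl
  have h3 := hK S hSm
  simp only [hO0] at h1
  have h4 := ENNReal.toReal_mono
    (ENNReal.mul_ne_top (by simp) (measure_ne_top _ _)) h1
  rw [ENNReal.toReal_mul, ENNReal.toReal_pow, ENNReal.toReal_ofNat] at h4
  refine h4.trans ?_
  change (2 : ℝ) ^ (n + 1) * ((Measure.pi fun _ : Fin n => P).prod (lawAdd X Y)).real S ≤ _
  calc (2 : ℝ) ^ (n + 1) * ((Measure.pi fun _ : Fin n => P).prod (lawAdd X Y)).real S
      ≤ 2 ^ (n + 1) *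
        (ε / 2 ^ (n + 1) + K * ‖∑ k, c k • AlgTensorPower.pure (m k)‖ ^ 2) := by
        gcongr
        exact h3.trans (by gcongr)
    _ = _ := by field_simp

end GeneralizedFunction

/-! ### The operator of moments and the Hilbert–Schmidt property -/

namespace GeneralizedFunction

variable {H : Type*} [NormedAddCommGroup H] [InnerProductSpace ℝ H]
  {T : Type*} [MeasurableSpace T] {μ : Measure T}

/-- The multilinear map `(ξ₁, …, ξₙ) ↦ ⟨Y, ξ₁⟩ ⋯ ⟨Y, ξₙ⟩`. -/
def prodMultilinear (Y : GeneralizedFunction H μ) (n : ℕ) :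
    MultilinearMap ℝ (fun _ : Fin n => H) (T →ₘ[μ] ℝ) where
  toFun ξ := ∏ i, Y (ξ i)
  map_update_add' {inst} m i x y := by
    have e : ∀ z, ∏ j, Y (Function.update m i z j) = Y z * ∏ j ∈ Finset.univ \ {i}, Y (m j) := by
      intro z
      rw [← Finset.prod_update_of_mem (Finset.mem_univ i)]
      refine Finset.prod_congr rfl fun j _ => ?_
      by_cases h : j = i
      · subst h; simp
      · simp [h]
    have h1 : Y (x + y) = Y x + Y y := map_add Y.toLinearMap x y
    rw [e, e, e, h1]
    set Q := ∏ j ∈ Finset.univ \ {i}, Y (m j)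
    refine AEEqFun.ext ?_
    filter_upwards [AEEqFun.coeFn_mul (Y x + Y y) Q, AEEqFun.coeFn_add (Y x) (Y y),
      AEEqFun.coeFn_add (Y x * Q) (Y y * Q), AEEqFun.coeFn_mul (Y x) Q,
      AEEqFun.coeFn_mul (Y y) Q] with t a1 a2 a3 a4 a5
    rw [a1, a3, Pi.mul_apply, Pi.add_apply, a2, a4, a5]
    simp only [Pi.mul_apply, Pi.add_apply]
    ring
  map_update_smul' {inst} m i c x := by
    have e : ∀ z, ∏ j, Y (Function.update m i z j) = Y z * ∏ j ∈ Finset.univ \ {i}, Y (m j) := by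
      intro z
      rw [← Finset.prod_update_of_mem (Finset.mem_univ i)]
      refine Finset.prod_congr rfl fun j _ => ?_
      by_cases h : j = i
      · subst h; simp
      · simp [h]
    have h1 : Y (c • x) = c • Y x := map_smul Y.toLinearMap c x
    rw [e, e, h1]
    set Q := ∏ j ∈ Finset.univ \ {i}, Y (m j)
    refine AEEqFun.ext ?_
    filter_upwards [AEEqFun.coeFn_mul (c • Y x) Q, AEEqFun.coeFn_smul c (Y x),
      AEEqFun.coeFn_smul c (Y x * Q), AEEqFun.coeFn_mul (Y x) Q] with t a1 a2 a3 a4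
    rw [a1, a3, Pi.mul_apply, Pi.smul_apply, a2, a4]
    simp only [Pi.mul_apply, Pi.smul_apply, smul_eq_mul]
    ring

/-- The linear operator `A ↦ ⟨Y^{⊗ n}, A⟩` on the algebraic tensor power. -/
def tensorOperator (Y : GeneralizedFunction H μ) (n : ℕ) :
    AlgTensorPower n H →ₗ[ℝ] (T →ₘ[μ] ℝ) :=
  (PiTensorProduct.lift (Y.prodMultilinear n) : (⨂[ℝ] _ : Fin n, H) →ₗ[ℝ] (T →ₘ[μ] ℝ))

theorem tensorOperator_pure (Y : GeneralizedFunction H μ) {n : ℕ} (ξ : Fin n → H) :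
    Y.tensorOperator n (AlgTensorPower.pure ξ) = ∏ i, Y (ξ i) :=
  PiTensorProduct.lift.tprod (φ := Y.prodMultilinear n) ξ

theorem coeFn_tensorOperator_pure (Y : GeneralizedFunction H μ) {n : ℕ} (ξ : Fin n → H) :
    ∀ᵐ t ∂μ, Y.tensorOperator n (AlgTensorPower.pure ξ) t = ∏ i, Y (ξ i) t := by
  rw [tensorOperator_pure]
  exact AEEqFun.coeFn_fun_finsetProd Finset.univ fun i => Y (ξ i)

theorem coeFn_tensorOperator_sum (Y : GeneralizedFunction H μ) {n N : ℕ} (c : Fin N → ℝ)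
    (m : Fin N → Fin n → H) :
    ∀ᵐ t ∂μ, Y.tensorOperator n (∑ k, c k • AlgTensorPower.pure (m k)) t =
      ∑ k, c k * ∏ i, Y (m k i) t := by
  have h1 : ∀ s : Finset (Fin N), ∀ᵐ t ∂μ,
      Y.tensorOperator n (∑ k ∈ s, c k • AlgTensorPower.pure (m k)) t =
        ∑ k ∈ s, c k * ∏ i, Y (m k i) t := by
    intro s
    induction s using Finset.induction_on with
    | empty =>
      simp only [Finset.sum_empty, map_zero]
      exact AEEqFun.coeFn_zero
    | insert a s ha ih =>
      rw [Finset.sum_insert ha, map_add, map_smul]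
      filter_upwards [ih, Y.coeFn_tensorOperator_pure (m a),
        AEEqFun.coeFn_smul (c a) (Y.tensorOperator n (AlgTensorPower.pure (m a))),
        AEEqFun.coeFn_add (c a • Y.tensorOperator n (AlgTensorPower.pure (m a)))
          (Y.tensorOperator n (∑ k ∈ s, c k • AlgTensorPower.pure (m k)))] with t e1 e2 e3 e4
      rw [e4, Pi.add_apply, e3, Pi.smul_apply, e2, e1, Finset.sum_insert ha, smul_eq_mul]
  exact h1 Finset.univ

theorem IsRandomizedShift.measureReal_tensorOperator_le {Ω : Type*} [MeasurableSpace Ω]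
    {P : Measure Ω} [IsProbabilityMeasure P] [IsProbabilityMeasure μ]
    {X : GeneralizedFunction H P} (hX : X.IsStandardGaussian) {Y : GeneralizedFunction H μ}
    (hY : IsRandomizedShift X Y) (n : ℕ) {ε : ℝ} (hε : 0 < ε) :
    ∃ K : ℝ, ∀ v, μ.real {t | 1 ≤ |Y.tensorOperator (n + 1) v t|} ≤ ε + K * ‖v‖ ^ 2 := by
  obtain ⟨K, hK⟩ := hY.measureReal_le hX n hε
  set s : ℝ := (√((n : ℝ) + 1))⁻¹ with hs
  have hs0 : 0 < s := inv_pos.2 (Real.sqrt_pos.2 (by positivity))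
  refine ⟨K * (s⁻¹ ^ (n + 1)) ^ 2, fun v => ?_⟩
  obtain ⟨N, c, m, rfl⟩ := AlgTensorPower.exists_sum v
  -- Rescaling the coefficients cancels the factor `s ^ (n + 1)` that the rotation puts on the
  -- shift.
  have h := hK N (fun k => s⁻¹ ^ (n + 1) * c k) m
  have e1 : ∑ k, (s⁻¹ ^ (n + 1) * c k) • AlgTensorPower.pure (m k) =
      s⁻¹ ^ (n + 1) • ∑ k, c k • AlgTensorPower.pure (m k) := by
    rw [Finset.smul_sum]
    simp_rw [mul_smul]
  have e2 : μ.real {t | 1 ≤ |Y.tensorOperator (n + 1) (∑ k, c k • AlgTensorPower.pure (m k)) t|} =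
      μ.real {t | 1 ≤ |∑ k, s⁻¹ ^ (n + 1) * c k * ∏ i, s * Y (m k i) t|} := by
    refine measureReal_congr ?_
    filter_upwards [Y.coeFn_tensorOperator_sum c m] with t ht
    refine congrArg (fun x : ℝ => 1 ≤ |x|) (ht.trans (Finset.sum_congr rfl fun k _ => ?_))
    rw [Finset.prod_mul_distrib, Finset.prod_const, Finset.card_univ, Fintype.card_fin,
      inv_pow]
    have : s ^ (n + 1) ≠ 0 := (pow_pos hs0 _).ne'
    field_simp
  rw [e2]
  refine h.trans (le_of_eq ?_)
  rw [e1, norm_smul, mul_pow, Real.norm_eq_abs, sq_abs]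
  ring

end GeneralizedFunction

/-- A bounded linear functional on the algebraic tensor power is given by a Hilbert–Schmidt
tensor. -/
theorem AlgTensorPower.isHilbertSchmidtTensor_of_bound {n : ℕ} {H : Type*} [NormedAddCommGroup H]
    [InnerProductSpace ℝ H] (L : AlgTensorPower n H →ₗ[ℝ] ℝ) {M : ℝ} (hM : 0 ≤ M)
    (hL : ∀ v, ‖v‖ ≤ 1 → |L v| ≤ M) :
    IsHilbertSchmidtTensor fun ξ => L (AlgTensorPower.pure ξ) := by
  have hbound : ∀ v, ‖L v‖ ≤ M * ‖v‖ := by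
    intro v
    -- Only a seminorm is at hand, so `v` is scaled by numbers `r > ‖v‖` rather than by `‖v‖`, which
    -- may vanish.
    have hr : ∀ r : ℝ, ‖v‖ < r → ‖L v‖ ≤ M * r := by
      intro r hr
      have hr0 : 0 < r := (norm_nonneg v).trans_lt hr
      have h := hL (r⁻¹ • v) (by
        rw [norm_smul, norm_inv, Real.norm_eq_abs, abs_of_pos hr0, ← div_eq_inv_mul]
        exact (div_le_one hr0).2 hr.le)
      rw [map_smul, smul_eq_mul, abs_mul, abs_inv, abs_of_pos hr0, ← div_eq_inv_mul,
        div_le_iff₀ hr0] at h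
      exact h
    refine le_of_forall_pos_le_add fun ε hε => ?_
    refine (hr (‖v‖ + ε / (M + 1)) (by linarith [show 0 < ε / (M + 1) by positivity])).trans ?_
    rw [mul_add]
    gcongr
    rw [← mul_div_assoc, div_le_iff₀ (by positivity)]
    nlinarith
  let Lc : AlgTensorPower n H →L[ℝ] ℝ := L.mkContinuous M hbound
  let Le : HilbertTensorPower n H →L[ℝ] ℝ :=
    Lc.extend (UniformSpace.Completion.toComplL (𝕜 := ℝ) (E := AlgTensorPower n H))
  refine ⟨(InnerProductSpace.toDual ℝ (HilbertTensorPower n H)).symm Le, fun ξ => ?_⟩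
  rw [InnerProductSpace.toDual_symm_apply]
  exact (ContinuousLinearMap.extend_eq Lc UniformSpace.Completion.denseRange_coe
    (UniformSpace.Completion.isUniformInducing_coe _) _).symm

theorem mainTheorem4 {H : Type*} [NormedAddCommGroup H] [InnerProductSpace ℝ H] [CompleteSpace H]
    [TopologicalSpace.SeparableSpace H]
    {Ω : Type*} [MeasurableSpace Ω] [StandardBorelSpace Ω]
    (P : Measure Ω) [IsProbabilityMeasure P]
    (X : GeneralizedFunction H P) (hX : X.IsStandardGaussian)
    {T : Type*} [MeasurableSpace T] [StandardBorelSpace T]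
    (μ : Measure T) [IsProbabilityMeasure μ]
    (Y : GeneralizedFunction H μ) (hY : GeneralizedFunction.IsRandomizedShift X Y) (n : ℕ) :
    ∃ μ' : Measure T, IsProbabilityMeasure μ' ∧ μ' ≪ μ ∧ μ ≪ μ' ∧
      (∀ ξ : H, Integrable (fun t => |Y ξ t| ^ n) μ') ∧
      IsHilbertSchmidtTensor (Y.momentForm μ' n) := by
  obtain ⟨μ', hp, hac, hac', M, hM⟩ : ∃ μ' : Measure T, IsProbabilityMeasure μ' ∧ μ' ≪ μ ∧ μ ≪ μ' ∧
      ∃ M : NNReal, ∀ v, ‖v‖ ≤ 1 → ∫⁻ t, ‖Y.tensorOperator n v t‖ₑ ∂μ' ≤ M := by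
    cases n with
    | zero =>
      -- In order `0` there is no copy to shift; the operator has constant values, of modulus equal
      -- to the norm, so `μ` itself works.
      refine ⟨μ, inferInstance, Measure.AbsolutelyContinuous.rfl,
        Measure.AbsolutelyContinuous.rfl, 1, fun v hv => ?_⟩
      obtain ⟨N, c, m, rfl⟩ := AlgTensorPower.exists_sum v
      have h1 : ‖∑ k, c k • AlgTensorPower.pure (m k)‖ ^ 2 = (∑ k, c k) ^ 2 := by
        rw [← real_inner_self_eq_norm_sq]
        simp_rw [sum_inner, inner_sum, real_inner_smul_left, real_inner_smul_right,
          AlgTensorPower.inner_pure]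
        simp [sq, Finset.sum_mul_sum]
      have h2 : ‖∑ k, c k‖ₑ ≤ 1 := by
        rw [← ofReal_norm, ENNReal.ofReal_le_one, Real.norm_eq_abs, ← sq_le_one_iff_abs_le_one,
          ← h1]
        exact pow_le_one₀ (norm_nonneg _) hv
      rw [lintegral_congr_ae (g := fun _ => ‖∑ k, c k‖ₑ)]
      · simpa using h2
      · filter_upwards [Y.coeFn_tensorOperator_sum c m] with t ht
        rw [ht]
        simp
    | succ n =>
      exact exists_equivalent_measure_bound _ fun ε hε =>
        hY.measureReal_tensorOperator_le hX n hε
  have hint : ∀ v, Integrable (Y.tensorOperator n v) μ' := by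
    intro v
    have h1 : ∀ w, ‖w‖ ≤ 1 → Integrable (Y.tensorOperator n w) μ' := fun w hw =>
      ⟨(Y.tensorOperator n w).measurable.aestronglyMeasurable,
        (hM w hw).trans_lt ENNReal.coe_lt_top⟩
    have hr0 : 0 < ‖v‖ + 1 := by positivity
    have h2 := h1 ((‖v‖ + 1)⁻¹ • v) (by
      rw [norm_smul, norm_inv, Real.norm_eq_abs, abs_of_pos hr0, ← div_eq_inv_mul]
      exact (div_le_one hr0).2 (by linarith))
    refine (h2.const_mul (‖v‖ + 1)).congr ?_
    rw [map_smul]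
    filter_upwards [hac.ae_le (AEEqFun.coeFn_smul (‖v‖ + 1)⁻¹ (Y.tensorOperator n v))] with t ht
    rw [ht, Pi.smul_apply, smul_eq_mul, mul_inv_cancel_left₀ hr0.ne']
  let L : AlgTensorPower n H →ₗ[ℝ] ℝ :=
    { toFun := fun v => ∫ t, Y.tensorOperator n v t ∂μ'
      map_add' := fun v w => by
        rw [← integral_add (hint v) (hint w), map_add]
        exact integral_congr_ae (hac.ae_le (AEEqFun.coeFn_add _ _))
      map_smul' := fun c v => by
        rw [RingHom.id_apply, smul_eq_mul, ← integral_const_mul, map_smul]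
        exact integral_congr_ae (hac.ae_le (AEEqFun.coeFn_smul _ _)) }
  have hL : ∀ v, ‖v‖ ≤ 1 → |L v| ≤ (M : ℝ) := by
    intro v hv
    have h := (enorm_integral_le_lintegral_enorm (Y.tensorOperator n v)).trans (hM v hv)
    rw [← ofReal_norm, ← ENNReal.ofReal_coe_nnreal] at h
    exact (ENNReal.ofReal_le_ofReal_iff M.2).1 h
  have hpure : ∀ ξ : Fin n → H, Y.tensorOperator n (AlgTensorPower.pure ξ) =ᵐ[μ']
      fun t => ∏ i, Y (ξ i) t := fun ξ => hac.ae_le (Y.coeFn_tensorOperator_pure ξ)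
  refine ⟨μ', hp, hac, hac', fun ξ => ?_, ?_⟩
  -- The tensor `ξ ⊗ ⋯ ⊗ ξ` yields the absolute moment of order `n`.
  · refine ((hint (AlgTensorPower.pure fun _ => ξ)).abs).congr ?_
    filter_upwards [hpure fun _ => ξ] with t ht
    rw [ht]
    simp
  · have h : Y.momentForm μ' n = fun ξ => L (AlgTensorPower.pure ξ) :=
      funext fun ξ => (integral_congr_ae (hpure ξ)).symm
    rw [h]
    exact AlgTensorPower.isHilbertSchmidtTensor_of_bound L M.2 hL

end
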